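/- Let $E$ be a finite-dimensional real vector space, $A\in\mathrm{End}_{\mathbb R}(E)$ and $f\in E^*$. Consider the program $P(A,f)$: while $(f(x)>0)$ $\{x:=Ax\}$. It is non-terminating on $x$ if $f(A^kx)>0$ for all $k\ge 0$; a vector $x\in E$ is ANT (asymptotically non-terminating) if there is $k_0\ge 0$ such that $P(A,f)$ is non-terminating on $A^{k_0}x$. Let $ANT(P(A,f))$ be the set of ANT vectors. For $\mu\in\mathbb R$ let $d_\mu\ge 0$ be the multiplicity of $\mu$ as a root of the characteristic polynomial of $A$ (so $d_\mu=0$ if $\mu$ is not an eigenvalue), $E_\mu(A)=\mathrm{Ker}((A-\mu)^{d_\mu})$ and $e_{|\mu|}=\max(d_{|\mu|},d_{-|\mu|})$. Assume that the spectrum $\mathrm{Spec}(A)$ is real (the characteristic polynomial splits over $\mathbb R$), that $K(A,f)=\bigcap_{k\ge0}\mathrm{Ker}(f\circ A^k)=\{0\}$ and that $E_0(A)=\{0\}$. Call a basis $B=\bigcup_{\mu\in \mathrm{Spec}(A)}\{e_{\mu,1},\dots,e_{\mu,d_\mu}\}$ of $E$, with $e_{\mu,j}\in E_\mu(A)$,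 adapted if $Ae_{\mu,1}=\mu e_{\mu,1}$ and $Ae_{\mu,j}=\mu(e_{\mu,j-1}+e_{\mu,j})$ for $2\le j\le d_\mu$. For an adapted basis write $x=\sum_{\mu,j}x_{\mu,j}e_{\mu,j}$ and $a_{\mu,j}=f(e_{\mu,j})$, and define polynomials in $k$ by $$P_{\mu,j}(k)=\sum_{i=1}^{j}a_{\mu,i}\binom{k}{j-i},\qquad P_\mu(x_\mu)=\sum_{j=1}^{d_\mu}x_{\mu,j}P_{\mu,j}=\sum_{l\ge 0}\phi_{\mu,l}(x_\mu)\,k^l$$ (zero if $\mu\notin\mathrm{Spec}(A)$), so that $\phi_{\mu,l}$ is a linear form and $\phi_{\mu,l}=0$ for $l\ge d_\mu$. Put $Q^{\pm}_\mu(x)=P_{|\mu|}(x_{|\mu|})\pm P_{-|\mu|}(x_{-|\mu|})$ and $\phi^{\pm}_{\mu,l}=\phi_{|\mu|,l}\pm\phi_{-|\mu|,l}$. A polynomial has a positive dominant term if it is nonzero with positive leading coefficient. Consider the following situations for $x\in E$, where $\lambda,\lambda',\mu$ denote eigenvalues of $A$. (1) There is $\lambda>0$ such that $P_\mu(x_\mu)=0$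 whenever $|\mu|>\lambda$, and both $Q^+_\lambda(x)$ and $Q^-_\lambda(x)$ have a positive dominant term. (2) There are $\lambda>0$ and $\lambda'$ with $|\lambda'|<\lambda$ such that $P_\mu(x_\mu)=0$ whenever $|\mu|>\lambda$, $Q^-_\lambda(x)=0$, $Q^+_\lambda(x)$ has a positive dominant term, $Q^-_\mu(x)=0$ whenever $|\lambda'|<|\mu|<\lambda$, and $Q^-_{\lambda'}(x)$ has a positive dominant term. (3) The same as (2) with $Q^+$ and $Q^-$ exchanged. Let $S$ be the union, over eigenvalues $\lambda>0$ and $k,k'\in\{0,\dots,d_\lambda-1\}$, of the sets $S^\lambda_{k,k'}$ of all $x$ such that $\phi_{\mu,j}(x_\mu)=0$ for all $|\mu|>\lambda$ and $0\le j\le d_\mu-1$; $\phi^+_{\lambda,j}(x)=0$ for $k<j\le e_\lambda-1$; $\phi^-_{\lambda,j}(x)=0$ for $k'<j\le e_\lambda-1$; $\phi^+_{\lambda,k}(x)>0$; and $\phi^-_{\lambda,k'}(x)>0$. Let $U$ be the union, over eigenvalues $\lambda>0$ and $\lambda'$ with $|\lambda'|<\lambda$, and $k\in\{0,\dots,d_\lambda-1\}$,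 $k'\in\{0,\dots,e_{|\lambda'|}-1\}$, of the sets $U^{\lambda,|\lambda'|}_{k,k'}$ of all $x$ such that $\phi_{\mu,j}(x_\mu)=0$ for all $|\mu|>\lambda$ and $0\le j\le d_\mu-1$; $\phi^-_{\lambda,j}(x)=0$ for $0\le j\le e_\lambda-1$; $\phi^-_{\mu,j}(x)=0$ for all $|\lambda'|<|\mu|<\lambda$ and $0\le j\le e_{|\mu|}-1$; $\phi_{\lambda,j}(x_\lambda)=0$ for $k<j\le d_\lambda-1$; $\phi^-_{\lambda',j}(x)=0$ for $k'<j\le e_{|\lambda'|}-1$; $\phi_{\lambda,k}(x_\lambda)>0$; and $\phi^-_{\lambda',k'}(x)>0$. Let $V$ be the union, over the same index set as $U$, of the sets $V^{\lambda,|\lambda'|}_{k,k'}$ defined by the same conditions with $\phi^-$ replaced by $\phi^+$ everywhere. Theorem. Adapted bases exist. For every adapted basis: (a) a vector $x\in E$ is ANT for $P(A,f)$ if and only if it is in situation (1), (2) or (3); (b) $ANT(P(A,f))=S\cup U\cup V$, and $S$, $U$, $V$ are pairwise disjoint. -/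

import Mathlib

/-!
Homogeneous linear loop programs `P(A, f) : while (f x > 0) { x := A x }` on a finite-dimensional
real vector space `E`, with `A` an endomorphism and `f` a linear form.
-/

noncomputable section

namespace LoopProgram

open Polynomial

variable {E : Type*} [AddCommGroup E] [Module ℝ E]

/-- `P(A, f)` is non-terminating on the input `x`: the guard holds at every iteration. -/
def NonTerminatingOn (A : Module.End ℝ E) (f : Module.Dual ℝ E) (x : E) : Prop :=
  ∀ k : ℕ, 0 < f ((A ^ k) x)

/-- `x` is an asymptotically non-terminating (ANT) value of `P(A, f)`. -/
def IsANT (A : Module.End ℝ E) (f : Module.Dual ℝ E) (x : E) : Prop :=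
  ∃ k₀ : ℕ, NonTerminatingOn A f ((A ^ k₀) x)

/-- The set `ANT(P(A, f))`. -/
def antSet (A : Module.End ℝ E) (f : Module.Dual ℝ E) : Set E :=
  {x | IsANT A f x}

/-- The subspace `K(A, f) = ⋂ₖ Ker (f ∘ Aᵏ)`. -/
def kerSpace (A : Module.End ℝ E) (f : Module.Dual ℝ E) : Submodule ℝ E :=
  ⨅ k : ℕ, LinearMap.ker (f ∘ₗ (A ^ k))

section Finite

variable [FiniteDimensional ℝ E]

/-- The multiplicity `d_μ` of `μ` as a root of the characteristic polynomial of `A`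
(it is `0` when `μ` is not an eigenvalue). -/
def mult (A : Module.End ℝ E) (μ : ℝ) : ℕ :=
  A.charpoly.rootMultiplicity μ

/-- The generalized eigenspace `E_μ(A) = Ker ((A - μ)^{d_μ})`. -/
def genSpace (A : Module.End ℝ E) (μ : ℝ) : Submodule ℝ E :=
  LinearMap.ker ((A - algebraMap ℝ (Module.End ℝ E) μ) ^ mult A μ)

/-- `e_{|μ|} = max (d_{|μ|}, d_{-|μ|})`. -/
def maxMult (A : Module.End ℝ E) (μ : ℝ) : ℕ :=
  max (mult A |μ|) (mult A (-|μ|))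

/-- Index type of the bases `B = ⋃_μ B_μ` of `E`, where `B_μ` has `d_μ` elements. Reals `μ` that are
not eigenvalues contribute nothing, since then `d_μ = 0`. The element `e_{μ,j}`, `1 ≤ j ≤ d_μ`,
of `B_μ` has the index `⟨μ, j - 1⟩`. -/
abbrev Idx (A : Module.End ℝ E) : Type :=
  Σ μ : ℝ, Fin (mult A μ)

/-- `B = ⋃_μ B_μ` with `B_μ` contained in `E_μ(A)`, and the matrix of `A` on `E_μ(A)` in `B_μ` is
`μ • T_μ`, where `T_μ` is the single `d_μ × d_μ` block with ones on the diagonal and on the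
superdiagonal and zeros elsewhere. -/
structure IsAdapted (A : Module.End ℝ E) (B : Module.Basis (Idx A) ℝ E) : Prop where
  mem : ∀ (μ : ℝ) (j : Fin (mult A μ)), B ⟨μ, j⟩ ∈ genSpace A μ
  map_first : ∀ (μ : ℝ) (h : 0 < mult A μ), A (B ⟨μ, ⟨0, h⟩⟩) = μ • B ⟨μ, ⟨0, h⟩⟩
  map_succ : ∀ (μ : ℝ) (j : ℕ) (h : j + 1 < mult A μ),
    A (B ⟨μ, ⟨j + 1, h⟩⟩) = μ • (B ⟨μ, ⟨j, Nat.lt_of_succ_lt h⟩⟩ + B ⟨μ, ⟨j + 1, h⟩⟩)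

/-- The polynomial `X (X - 1) ⋯ (X - m + 1) / m!`, whose value at `k ∈ ℕ` is the binomial
coefficient `k.choose m`. -/
def binomPoly (m : ℕ) : ℝ[X] :=
  C ((m.factorial : ℝ)⁻¹) * descPochhammer ℝ m

variable {A : Module.End ℝ E} (B : Module.Basis (Idx A) ℝ E) (f : Module.Dual ℝ E)

/-- The polynomial `P_{μ,j}(k) = ∑_{i ≤ j} a_{μ,i} (k choose (j - i))`, where `a_{μ,i} = f(e_{μ,i})`
are the coordinates of `f`. -/
def basisPoly (μ : ℝ) (j : Fin (mult A μ)) : ℝ[X] :=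
  ∑ i ∈ Finset.Iic j, C (f (B ⟨μ, i⟩)) * binomPoly ((j : ℕ) - (i : ℕ))

/-- The polynomial `P_μ(x_μ) = ∑_j x_{μ,j} P_{μ,j}`; it is zero if `μ` is not an eigenvalue. -/
def polyP (μ : ℝ) (x : E) : ℝ[X] :=
  ∑ j : Fin (mult A μ), C (B.repr x ⟨μ, j⟩) * basisPoly B f μ j

/-- `Q⁺_{±μ}(x_{±μ}) = P_{|μ|}(x_{|μ|}) + P_{-|μ|}(x_{-|μ|})`. -/
def polyQPlus (μ : ℝ) (x : E) : ℝ[X] :=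
  polyP B f |μ| x + polyP B f (-|μ|) x

/-- `Q⁻_{±μ}(x_{±μ}) = P_{|μ|}(x_{|μ|}) - P_{-|μ|}(x_{-|μ|})`. -/
def polyQMinus (μ : ℝ) (x : E) : ℝ[X] :=
  polyP B f |μ| x - polyP B f (-|μ|) x

/-- The linear form `φ_{μ,l}(x_μ) = ∑_j b_{μ,l}^j x_{μ,j}`, where `b_{μ,l}^j` is the coefficient of
degree `l` of `P_{μ,j}`. -/
def phi (μ : ℝ) (l : ℕ) (x : E) : ℝ :=
  ∑ j : Fin (mult A μ), (basisPoly B f μ j).coeff l * B.repr x ⟨μ, j⟩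

/-- `φ⁺_{±μ,l} = φ_{|μ|,l} + φ_{-|μ|,l}`. -/
def phiPlus (μ : ℝ) (l : ℕ) (x : E) : ℝ :=
  phi B f |μ| l x + phi B f (-|μ|) l x

/-- `φ⁻_{±μ,l} = φ_{|μ|,l} - φ_{-|μ|,l}`. -/
def phiMinus (μ : ℝ) (l : ℕ) (x : E) : ℝ :=
  phi B f |μ| l x - phi B f (-|μ|) l x

/-- A polynomial has a positive dominant term: it is nonzero, with positive leading coefficient
(the leading coefficient of `0` is `0`). -/
def PosDominant (p : ℝ[X]) : Prop :=
  0 < p.leadingCoeff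

/-- First dominant-term situation. -/
def SituationS (x : E) : Prop :=
  ∃ l : ℝ, 0 < l ∧ A.HasEigenvalue l ∧
    PosDominant (polyQPlus B f l x) ∧
    PosDominant (polyQMinus B f l x) ∧
    ∀ μ : ℝ, A.HasEigenvalue μ → l < |μ| → polyP B f μ x = 0

/-- Second dominant-term situation. -/
def SituationU (x : E) : Prop :=
  ∃ l l' : ℝ, 0 < l ∧ A.HasEigenvalue l ∧ A.HasEigenvalue l' ∧ |l'| < l ∧
    (∀ μ : ℝ, A.HasEigenvalue μ → l < |μ| → polyP B f μ x = 0) ∧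
    polyQMinus B f l x = 0 ∧
    PosDominant (polyQPlus B f l x) ∧
    (∀ μ : ℝ, A.HasEigenvalue μ → |l'| < |μ| → |μ| < l → polyQMinus B f μ x = 0) ∧
    PosDominant (polyQMinus B f l' x)

/-- Third dominant-term situation. -/
def SituationV (x : E) : Prop :=
  ∃ l l' : ℝ, 0 < l ∧ A.HasEigenvalue l ∧ A.HasEigenvalue l' ∧ |l'| < l ∧
    (∀ μ : ℝ, A.HasEigenvalue μ → l < |μ| → polyP B f μ x = 0) ∧
    polyQPlus B f l x = 0 ∧
    PosDominant (polyQMinus B f l x) ∧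
    (∀ μ : ℝ, A.HasEigenvalue μ → |l'| < |μ| → |μ| < l → polyQPlus B f μ x = 0) ∧
    PosDominant (polyQPlus B f l' x)

/-- The semi-linear set `S_{k,k'}^l`. -/
def pieceS (l : ℝ) (k k' : ℕ) : Set E :=
  {x | (∀ μ : ℝ, A.HasEigenvalue μ → l < |μ| → ∀ j < mult A μ, phi B f μ j x = 0) ∧
    (∀ j < maxMult A l, k < j → phiPlus B f l j x = 0) ∧
    (∀ j < maxMult A l, k' < j → phiMinus B f l j x = 0) ∧
    0 < phiPlus B f l k x ∧
    0 < phiMinus B f l k' x}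

/-- The set `S`. -/
def setS : Set E :=
  {x | ∃ (l : ℝ) (k k' : ℕ), 0 < l ∧ A.HasEigenvalue l ∧
    k < mult A l ∧ k' < mult A l ∧ x ∈ pieceS B f l k k'}

/-- The semi-linear set `U_{k,k'}^{l,|l'|}`. -/
def pieceU (l l' : ℝ) (k k' : ℕ) : Set E :=
  {x | (∀ μ : ℝ, A.HasEigenvalue μ → l < |μ| → ∀ j < mult A μ, phi B f μ j x = 0) ∧
    (∀ j < maxMult A l, phiMinus B f l j x = 0) ∧
    (∀ μ : ℝ, A.HasEigenvalue μ → |l'| < |μ| → |μ| < l →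
      ∀ j < maxMult A μ, phiMinus B f μ j x = 0) ∧
    (∀ j < mult A l, k < j → phi B f l j x = 0) ∧
    (∀ j < maxMult A l', k' < j → phiMinus B f l' j x = 0) ∧
    0 < phi B f l k x ∧
    0 < phiMinus B f l' k' x}

/-- The set `U`. -/
def setU : Set E :=
  {x | ∃ (l l' : ℝ) (k k' : ℕ), 0 < l ∧ A.HasEigenvalue l ∧ A.HasEigenvalue l' ∧ |l'| < l ∧
    k < mult A l ∧ k' < maxMult A l' ∧ x ∈ pieceU B f l l' k k'}

/-- The semi-linear set `V_{k,k'}^{l,|l'|}`. -/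
def pieceV (l l' : ℝ) (k k' : ℕ) : Set E :=
  {x | (∀ μ : ℝ, A.HasEigenvalue μ → l < |μ| → ∀ j < mult A μ, phi B f μ j x = 0) ∧
    (∀ j < maxMult A l, phiPlus B f l j x = 0) ∧
    (∀ μ : ℝ, A.HasEigenvalue μ → |l'| < |μ| → |μ| < l →
      ∀ j < maxMult A μ, phiPlus B f μ j x = 0) ∧
    (∀ j < mult A l, k < j → phi B f l j x = 0) ∧
    (∀ j < maxMult A l', k' < j → phiPlus B f l' j x = 0) ∧
    0 < phi B f l k x ∧
    0 < phiPlus B f l' k' x}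

/-- The set `V`. -/
def setV : Set E :=
  {x | ∃ (l l' : ℝ) (k k' : ℕ), 0 < l ∧ A.HasEigenvalue l ∧ A.HasEigenvalue l' ∧ |l'| < l ∧
    k < mult A l ∧ k' < maxMult A l' ∧ x ∈ pieceV B f l l' k k'}

end Finite

end LoopProgram

end

/-! In an adapted basis, Pascal's rule gives `f (A^k x)` as the sum over eigenvalues of `μ^k *
P_μ(k)`. Grouping `μ` with `-μ` turns this into the sum over `t = |μ| > 0` of `t^k * Q⁺_t(k)` for
even `k` and of `t^k * Q⁻_t(k)` for odd `k`. Such a sum has the sign of its dominant term for large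
`k`. So `x` is ANT exactly when each of the families `Q⁺`, `Q⁻` has a positive dominant term
(`IsAdapted.isANT_iff_isDominantAt`).

The radius carrying the dominant term of a family is unique. Comparing the radii `t` for `Q⁺` and
`t'` for `Q⁻` gives the three situations, `t = t'`, `t > t'` and `t < t'`, and hence disjointness.
The sets `S`, `U`, `V` express the same conditions through coefficients; only the bounds on `k`,
`k'` need an argument.

Adapted bases exist because `K(A, f) = 0` makes `f` injective on each eigenspace, so each eigenvalue
has a single Jordan block; `E_0(A) = 0` allows the nilpotent part to be rescaled by `μ⁻¹`. -/

namespace LoopProgram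

open Polynomial Filter Topology

/-! ### Eventual sign of exponential-polynomial sums -/

/-- Along a family of polynomials `Q t` indexed by the reals, `t > 0` carries the dominant term of
`∑ t ^ n * Q t n`, and this dominant term is positive. -/
def IsDominantAt (Q : ℝ → ℝ[X]) (t : ℝ) : Prop :=
  0 < t ∧ PosDominant (Q t) ∧ ∀ s, t < s → Q s = 0

theorem PosDominant.ne_zero {p : ℝ[X]} (h : PosDominant p) : p ≠ 0 := by
  rintro rfl
  simp [PosDominant] at h

theorem IsDominantAt.unique {Q : ℝ → ℝ[X]} {s t : ℝ} (hs : IsDominantAt Q s)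
    (ht : IsDominantAt Q t) : s = t := by
  rcases lt_trichotomy s t with h | h | h
  · exact absurd (hs.2.2 t h) ht.2.1.ne_zero
  · exact h
  · exact absurd (ht.2.2 s h) hs.2.1.ne_zero

theorem PosDominant.eventually_le_eval {p : ℝ[X]} (h : PosDominant p) :
    ∃ c > 0, ∀ᶠ n : ℕ in atTop, c ≤ p.eval (n : ℝ) := by
  by_cases hd : 0 < p.degree
  · exact ⟨1, one_pos, ((p.tendsto_atTop_of_leadingCoeff_nonneg hd h.le).comp
      tendsto_natCast_atTop_atTop).eventually_ge_atTop 1⟩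
  · refine ⟨p.leadingCoeff, h, Eventually.of_forall fun n => ?_⟩
    rw [eq_C_of_degree_le_zero (not_lt.mp hd)]
    simp

theorem tendsto_pow_mul_eval_of_abs_lt_one (p : ℝ[X]) {r : ℝ} (hr : |r| < 1) :
    Tendsto (fun n : ℕ => r ^ n * p.eval (n : ℝ)) atTop (𝓝 0) := by
  simp only [eval_eq_sum_range, Finset.mul_sum]
  rw [← Finset.sum_const_zero (s := Finset.range (p.natDegree + 1))]
  refine tendsto_finsetSum _ fun i _ => ?_
  have := (tendsto_pow_const_mul_const_pow_of_abs_lt_one i hr).const_mul (p.coeff i)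
  rw [mul_zero] at this
  exact this.congr fun n => by ring

/-- After factoring out `t^n`, the term of `Q t` stays above a positive constant, while the terms
with `s < t` tend to `0` and those with `s > t` vanish. -/
theorem IsDominantAt.eventually_sum_pos {Q : ℝ → ℝ[X]} {T : Finset ℝ} (hT : ∀ t ∈ T, 0 < t)
    (hQ : ∀ t, 0 < t → t ∉ T → Q t = 0) {t : ℝ} (h : IsDominantAt Q t) :
    ∀ᶠ n : ℕ in atTop, 0 < ∑ s ∈ T, s ^ n * (Q s).eval (n : ℝ) := by
  obtain ⟨ht, hp, hz⟩ := h
  have htT : t ∈ T := by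
    by_contra hn
    exact hp.ne_zero (hQ t ht hn)
  obtain ⟨c, hc, hev⟩ := hp.eventually_le_eval
  have hlim : Tendsto (fun n : ℕ => ∑ s ∈ T.erase t, (s / t) ^ n * (Q s).eval (n : ℝ))
      atTop (𝓝 0) := by
    rw [← Finset.sum_const_zero (s := T.erase t)]
    refine tendsto_finsetSum _ fun s hs => ?_
    obtain ⟨hne, hsT⟩ := Finset.mem_erase.mp hs
    rcases lt_or_gt_of_ne hne with hlt | hgt
    · refine tendsto_pow_mul_eval_of_abs_lt_one _ ?_
      rw [abs_of_pos (div_pos (hT s hsT) ht), div_lt_one ht]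
      exact hlt
    · simp [hz s hgt]
  filter_upwards [hev, hlim.eventually (lt_mem_nhds (neg_lt_zero.mpr hc))]
    with n h1 h2
  have hsum : ∑ s ∈ T, s ^ n * (Q s).eval (n : ℝ) =
      t ^ n * ((Q t).eval (n : ℝ) + ∑ s ∈ T.erase t, (s / t) ^ n * (Q s).eval (n : ℝ)) := by
    rw [← Finset.add_sum_erase _ _ htT, mul_add, Finset.mul_sum]
    congr 1
    refine Finset.sum_congr rfl fun s _ => ?_
    rw [div_pow, ← mul_assoc, mul_div_cancel₀ _ (pow_ne_zero n ht.ne')]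
  rw [hsum]
  exact mul_pos (pow_pos ht n) (by linarith)

/-- For the converse, take the largest `t` with `Q t ≠ 0`: a negative leading coefficient there
would make the sum for `-Q` eventually positive. The map `φ` serves for the even and the odd
subsequences. -/
theorem eventually_sum_pos_iff {Q : ℝ → ℝ[X]} {T : Finset ℝ} (hT : ∀ t ∈ T, 0 < t)
    (hQ : ∀ t, 0 < t → t ∉ T → Q t = 0) {φ : ℕ → ℕ} (hφ : Tendsto φ atTop atTop) :
    (∀ᶠ m in atTop, 0 < ∑ s ∈ T, s ^ φ m * (Q s).eval (φ m : ℝ)) ↔ ∃ t, IsDominantAt Q t := by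
  classical
  refine ⟨fun hev => ?_, fun ⟨t, h⟩ => hφ.eventually (h.eventually_sum_pos hT hQ)⟩
  have hne : (T.filter fun t => Q t ≠ 0).Nonempty := by
    by_contra hn
    obtain ⟨m, hm⟩ := hev.exists
    refine hm.ne' (Finset.sum_eq_zero fun s hs => ?_)
    by_cases h0 : Q s = 0
    · simp [h0]
    · exact absurd ⟨s, Finset.mem_filter.mpr ⟨hs, h0⟩⟩ hn
  obtain ⟨t, htm, hmax⟩ := Finset.exists_max_image _ id hne
  obtain ⟨htT, ht0⟩ := Finset.mem_filter.mp htm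
  have hz : ∀ s, t < s → Q s = 0 := by
    intro s hs
    by_cases hsT : s ∈ T
    · by_contra h0
      exact absurd (hmax s (Finset.mem_filter.mpr ⟨hsT, h0⟩)) (not_le.mpr hs)
    · exact hQ s ((hT t htT).trans hs) hsT
  refine ⟨t, hT t htT, ?_, hz⟩
  by_contra hneg
  have hlt : (Q t).leadingCoeff < 0 :=
    lt_of_le_of_ne (not_lt.mp hneg) (leadingCoeff_ne_zero.mpr ht0)
  have hdom : IsDominantAt (fun s => -Q s) t :=
    ⟨hT t htT, by simpa [PosDominant] using hlt, fun s hs => by simp [hz s hs]⟩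
  have hev' := hφ.eventually
    (hdom.eventually_sum_pos hT fun s hs hsT => by simp [hQ s hs hsT])
  obtain ⟨m, h1, h2⟩ := (hev.and hev').exists
  simp only [eval_neg, mul_neg, Finset.sum_neg_distrib] at h2
  linarith

end LoopProgram

/-! ### Single Jordan blocks and existence of adapted bases -/

namespace LoopProgram

open Polynomial Filter Topology

theorem linearIndependent_pow_apply {K V : Type*} [Field K] [AddCommGroup V] [Module K V]
    (N : Module.End K V) (v : V) (d : ℕ) (hd : (N ^ d) v = 0)
    (hne : ∀ i < d, (N ^ i) v ≠ 0) : LinearIndependent K fun i : Fin d => (N ^ (i : ℕ)) v := by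
  rw [Fintype.linearIndependent_iff]
  intro c hc i
  obtain ⟨i, hi⟩ := i
  induction i using Nat.strong_induction_on with
  | _ i ih =>
    -- This power kills the terms of index above `i` and sends the `i`-th vector to the nonzero
    -- `N^(d-1) v`; the coefficients below `i` vanish by induction.
    have h := congrArg (N ^ (d - 1 - i)) hc
    rw [map_sum, map_zero, Finset.sum_eq_single ⟨i, hi⟩] at h
    · rw [map_smul, ← Module.End.mul_apply, ← pow_add] at h
      exact (smul_eq_zero.mp h).resolve_right (hne _ (by simp only; omega))
    · intro j _ hj
      have hji : (j : ℕ) ≠ i := fun h => hj (Fin.ext h)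
      rcases lt_or_gt_of_ne hji with hlt | hgt
      · rw [show c j = 0 from ih j hlt j.2, zero_smul, map_zero]
      · rw [map_smul, ← Module.End.mul_apply, ← pow_add,
          show d - 1 - i + (j : ℕ) = (j - 1 - i) + d by omega, pow_add, Module.End.mul_apply, hd,
          map_zero, smul_zero]
    · simp

/-- `N^m` maps `ker N^(m+1)` into `ker N`, with kernel inside `ker N^m`; rank-nullity gives the
induction step. -/
theorem finrank_ker_pow_le {K V : Type*} [Field K] [AddCommGroup V] [Module K V]
    [FiniteDimensional K V] (N : Module.End K V) (m : ℕ) :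
    Module.finrank K (LinearMap.ker (N ^ m)) ≤ m * Module.finrank K (LinearMap.ker N) := by
  induction m with
  | zero =>
    rw [pow_zero, show LinearMap.ker (1 : Module.End K V) = ⊥ from LinearMap.ker_id]
    simp
  | succ m ih =>
    let g : LinearMap.ker (N ^ (m + 1)) →ₗ[K] LinearMap.ker N :=
      ((N ^ m).comp (LinearMap.ker (N ^ (m + 1))).subtype).codRestrict _ (fun x => by
        rw [LinearMap.mem_ker, LinearMap.comp_apply, ← Module.End.mul_apply, ← pow_succ']
        exact x.2)
    have hker : Module.finrank K (LinearMap.ker g) ≤ Module.finrank K (LinearMap.ker (N ^ m)) := by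
      let h : LinearMap.ker g →ₗ[K] LinearMap.ker (N ^ m) :=
        ((LinearMap.ker (N ^ (m + 1))).subtype.comp (LinearMap.ker g).subtype).codRestrict _
          (fun x => congrArg Subtype.val x.2)
      refine LinearMap.finrank_le_finrank_of_injective (f := h) fun x y hxy => ?_
      exact Subtype.ext (Subtype.ext (congrArg (fun z : LinearMap.ker (N ^ m) => (z : V)) hxy))
    have := LinearMap.finrank_range_add_finrank_ker g
    have := Submodule.finrank_le (LinearMap.range g)
    rw [Nat.succ_mul]
    omega

variable {E : Type*} [AddCommGroup E] [Module ℝ E]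

/-- The form `f` is injective on the eigenspace: if `A v = μ v` and `f v = 0`, then `f (A^k v) = μ^k
f v = 0` for all `k`, so `v` lies in `K(A, f)`. -/
theorem finrank_ker_sub_le_one {A : Module.End ℝ E} {f : Module.Dual ℝ E}
    (hK : kerSpace A f = ⊥) (μ : ℝ) :
    Module.finrank ℝ (LinearMap.ker (A - algebraMap ℝ (Module.End ℝ E) μ)) ≤ 1 := by
  rw [← Module.finrank_self ℝ]
  refine LinearMap.finrank_le_finrank_of_injective
    (f := f.comp (LinearMap.ker (A - algebraMap ℝ (Module.End ℝ E) μ)).subtype) ?_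
  rw [injective_iff_map_eq_zero]
  rintro ⟨v, hv⟩ hfv
  have hA : A v = μ • v := by
    simpa [sub_eq_zero, Module.algebraMap_end_apply] using hv
  have hpow : ∀ k : ℕ, (A ^ k) v = μ ^ k • v := by
    intro k
    induction k with
    | zero => simp
    | succ k ih => rw [pow_succ', Module.End.mul_apply, ih, map_smul, hA, smul_smul, pow_succ]
  have hmem : v ∈ kerSpace A f := by
    rw [kerSpace, Submodule.mem_iInf]
    intro k
    have : f v = 0 := hfv
    simp [hpow, this]
  rw [hK, Submodule.mem_bot] at hmem
  exact Subtype.ext hmem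

variable [FiniteDimensional ℝ E]

theorem hasEigenvalue_iff_mult_pos (A : Module.End ℝ E) (μ : ℝ) :
    A.HasEigenvalue μ ↔ 0 < mult A μ := by
  rw [Module.End.hasEigenvalue_iff_isRoot_charpoly, mult,
    Polynomial.rootMultiplicity_pos (LinearMap.charpoly_monic A).ne_zero]

theorem mult_zero_of_genSpace_zero {A : Module.End ℝ E} (h : genSpace A 0 = ⊥) :
    mult A 0 = 0 := by
  by_contra hne
  obtain ⟨v, hv⟩ :=
    ((hasEigenvalue_iff_mult_pos A 0).mpr (Nat.pos_of_ne_zero hne)).exists_hasEigenvector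
  refine hv.2 ((Submodule.mem_bot ℝ).mp (h ▸ ?_))
  have hA : A v = 0 := by simpa using hv.apply_eq_smul
  obtain ⟨d, hd⟩ := Nat.exists_eq_succ_of_ne_zero hne
  simp [genSpace, hd, pow_succ, hA]

/-- The generalized eigenspace has dimension `d_μ`, whereas `ker N^(d_μ - 1)` has dimension at most
`d_μ - 1` because `ker N` is at most a line. Any vector of the former outside the latter works. -/
theorem exists_cyclic_vector {A : Module.End ℝ E} {f : Module.Dual ℝ E}
    (hK : kerSpace A f = ⊥) (μ : ℝ) :
    ∃ v : E, ((A - algebraMap ℝ (Module.End ℝ E) μ) ^ mult A μ) v = 0 ∧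
      ∀ i < mult A μ, ((A - algebraMap ℝ (Module.End ℝ E) μ) ^ i) v ≠ 0 := by
  set N := A - algebraMap ℝ (Module.End ℝ E) μ with hN
  have hN1 : A - μ • 1 = N := by rw [hN, Algebra.algebraMap_eq_smul_one]
  rcases Nat.eq_zero_or_pos (mult A μ) with h0 | hpos
  · exact ⟨0, by simp, fun i hi => by omega⟩
  have hfin : Module.finrank ℝ (A.maxGenEigenspace μ) = mult A μ :=
    LinearMap.finrank_maxGenEigenspace_eq A μ
  have hnle : ¬ A.maxGenEigenspace μ ≤ LinearMap.ker (N ^ (mult A μ - 1)) := by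
    intro hle
    have h1 := Submodule.finrank_mono hle
    have h2 := finrank_ker_pow_le N (mult A μ - 1)
    have h3 := Nat.mul_le_mul_left (mult A μ - 1) (finrank_ker_sub_le_one hK μ)
    rw [← hN] at h3
    omega
  obtain ⟨v, hv, hvne⟩ := SetLike.not_le_iff_exists.mp hnle
  rw [LinearMap.mem_ker] at hvne
  have hv' := (A.mem_maxGenEigenspace μ v).mp hv
  rw [hN1] at hv'
  classical
  set p := Nat.find hv' with hp
  have hpv : (N ^ p) v = 0 := Nat.find_spec hv'
  have hpmin : ∀ i < p, (N ^ i) v ≠ 0 := fun i hi => Nat.find_min hv' hi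
  -- The `p` independent vectors `N^i v` all lie in a space of dimension `d_μ`.
  have hle : p ≤ mult A μ := by
    have hmem : ∀ i : ℕ, (N ^ i) v ∈ A.maxGenEigenspace μ := fun i => by
      rw [Module.End.mem_maxGenEigenspace, hN1]
      exact ⟨p, by rw [← Module.End.mul_apply, ← pow_add, add_comm, pow_add,
        Module.End.mul_apply, hpv, map_zero]⟩
    have hli := linearIndependent_pow_apply N v p hpv hpmin
    have hli' : LinearIndependent ℝ
        fun i : Fin p => (⟨(N ^ (i : ℕ)) v, hmem i⟩ : A.maxGenEigenspace μ) :=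
      LinearIndependent.of_comp (A.maxGenEigenspace μ).subtype hli
    simpa [hfin] using hli'.fintype_card_le_finrank
  have hge : mult A μ ≤ p := by
    by_contra hlt
    refine hvne ?_
    rw [show mult A μ - 1 = (mult A μ - 1 - p) + p by omega, pow_add, Module.End.mul_apply, hpv,
      map_zero]
  have hpd : p = mult A μ := le_antisymm hle hge
  exact ⟨v, hpd ▸ hpv, hpd ▸ hpmin⟩

theorem genSpace_le_maxGenEigenspace (A : Module.End ℝ E) (μ : ℝ) :
    genSpace A μ ≤ A.maxGenEigenspace μ := fun v hv => by
  rw [Module.End.mem_maxGenEigenspace, ← Algebra.algebraMap_eq_smul_one]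
  exact ⟨mult A μ, hv⟩

/-- The roots of the characteristic polynomial. -/
noncomputable def spec (A : Module.End ℝ E) : Finset ℝ := A.charpoly.roots.toFinset

theorem mem_spec {A : Module.End ℝ E} {μ : ℝ} : μ ∈ spec A ↔ 0 < mult A μ := by
  rw [spec, Multiset.mem_toFinset, ← Multiset.count_pos, Polynomial.count_roots, mult]

theorem mem_sigma_spec {A : Module.End ℝ E} (i : Idx A) :
    i ∈ (spec A).sigma fun _ => Finset.univ :=
  Finset.mem_sigma.mpr ⟨mem_spec.mpr (i.2.pos), Finset.mem_univ _⟩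

/-- The first component ranges over all reals, but the fibre is empty off the spectrum. -/
noncomputable instance idxFintype (A : Module.End ℝ E) : Fintype (Idx A) :=
  ⟨(spec A).sigma fun _ => Finset.univ, mem_sigma_spec⟩

theorem sum_idx {A : Module.End ℝ E} {M : Type*} [AddCommMonoid M] (F : Idx A → M) :
    ∑ i, F i = ∑ μ ∈ spec A, ∑ j : Fin (mult A μ), F ⟨μ, j⟩ :=
  Finset.sum_sigma _ _ _

theorem card_idx {A : Module.End ℝ E} (hspec : A.charpoly.Splits) :
    Fintype.card (Idx A) = Module.finrank ℝ E := by
  rw [← LinearMap.charpoly_natDegree A, hspec.natDegree_eq_card_roots,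
    ← Multiset.toFinset_sum_count_eq, Fintype.card_eq_sum_ones, sum_idx]
  refine Finset.sum_congr rfl fun μ _ => ?_
  rw [Finset.sum_const, Finset.card_univ, Fintype.card_fin, smul_eq_mul, mul_one, mult,
    Polynomial.count_roots]

theorem exists_isAdapted {A : Module.End ℝ E} {f : Module.Dual ℝ E}
    (hspec : A.charpoly.Splits) (hK : kerSpace A f = ⊥) (hE0 : genSpace A 0 = ⊥) :
    ∃ B : Module.Basis (Idx A) ℝ E, IsAdapted A B := by
  choose v hv0 hvne using fun μ => exists_cyclic_vector hK μ
  set N : ℝ → Module.End ℝ E := fun μ => A - algebraMap ℝ (Module.End ℝ E) μ with hN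
  -- With `M = μ⁻¹ N`, one has `A = μ (M + 1)`, so the required relations say that `M` lowers the
  -- index by one and kills the first vector. The chain is therefore the powers of `M` on the cyclic
  -- vector in reverse order.
  let e : ∀ μ : ℝ, ℕ → E := fun μ j =>
    ((μ⁻¹ • N μ) ^ (mult A μ - 1 - j)) (v μ)
  have hμ0 : ∀ μ, 0 < mult A μ → μ ≠ 0 := by
    rintro μ h rfl
    exact h.ne' (mult_zero_of_genSpace_zero hE0)
  have hmem : ∀ μ j, e μ j ∈ genSpace A μ := fun μ j => by
    simp only [e, genSpace, LinearMap.mem_ker]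
    rw [_root_.smul_pow, LinearMap.smul_apply, map_smul, ← Module.End.mul_apply, ← pow_add,
      add_comm, pow_add, Module.End.mul_apply, hv0,
      map_zero, smul_zero]
  have hli : ∀ μ, LinearIndependent ℝ fun j : Fin (mult A μ) => e μ j := fun μ => by
    have h : LinearIndependent ℝ fun i : Fin (mult A μ) => ((μ⁻¹ • N μ) ^ (i : ℕ)) (v μ) :=
      linearIndependent_pow_apply (μ⁻¹ • N μ) (v μ) (mult A μ)
      (by rw [_root_.smul_pow, LinearMap.smul_apply, hv0, smul_zero]) (fun i hi => by
        rw [_root_.smul_pow, LinearMap.smul_apply]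
        exact smul_ne_zero (pow_ne_zero _ (inv_ne_zero (hμ0 μ (by omega)))) (hvne μ i hi))
    have h2 := h.comp Fin.rev Fin.rev_injective
    convert h2 using 2 with j
    simp only [Function.comp, e, Fin.val_rev]
    congr 2
    omega
  have hLI : LinearIndependent ℝ fun i : Idx A => e i.1 i.2 := by
    refine linearIndependent_iUnion_finite (f := fun μ (j : Fin (mult A μ)) => e μ j) hli ?_
    intro μ t _ hμt
    have hsp : ∀ ν, Submodule.span ℝ (Set.range fun j : Fin (mult A ν) => e ν j) ≤
        A.maxGenEigenspace ν := fun ν => by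
      rw [Submodule.span_le]
      rintro _ ⟨j, rfl⟩
      exact genSpace_le_maxGenEigenspace A ν (hmem ν j)
    refine (A.independent_maxGenEigenspace μ).mono (hsp μ) (iSup₂_le fun ν hν => ?_)
    exact (hsp ν).trans (le_iSup₂_of_le ν (fun h => hμt (h ▸ hν)) le_rfl)
  -- Splitting of the characteristic polynomial enters here: the multiplicities add up to `dim E`.
  have hspan := hLI.span_eq_top_of_card_eq_finrank' (card_idx hspec)
  have hA : ∀ μ, 0 < mult A μ → ∀ w, A w = μ • ((μ⁻¹ • N μ) w + w) := fun μ h w => by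
    simp only [hN, LinearMap.smul_apply, smul_add, smul_inv_smul₀ (hμ0 μ h), LinearMap.sub_apply,
      Module.algebraMap_end_apply, sub_add_cancel]
  refine ⟨Module.Basis.mk hLI hspan.ge, ⟨fun μ j => ?_, fun μ h => ?_, fun μ j h => ?_⟩⟩
  · rw [Module.Basis.mk_apply]
    exact hmem μ j
  · rw [Module.Basis.mk_apply, hA μ h]
    simp only [e]
    rw [← Module.End.mul_apply, ← pow_succ', show mult A μ - 1 - 0 + 1 = mult A μ by omega,
      _root_.smul_pow, LinearMap.smul_apply, hv0, smul_zero, zero_add]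
  · rw [Module.Basis.mk_apply, Module.Basis.mk_apply, hA μ (by omega)]
    simp only [e]
    rw [← Module.End.mul_apply, ← pow_succ',
      show mult A μ - 1 - (j + 1) + 1 = mult A μ - 1 - j by omega]

end LoopProgram

/-! ### Iterates in an adapted basis, and the parity criterion -/

namespace LoopProgram

open Polynomial Filter Topology

theorem binomPoly_eval (m k : ℕ) : (binomPoly m).eval (k : ℝ) = (k.choose m : ℝ) := by
  rw [binomPoly, eval_mul, eval_C, descPochhammer_eval_eq_descFactorial,
    Nat.descFactorial_eq_factorial_mul_choose, Nat.cast_mul,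
    inv_mul_cancel_left₀ (Nat.cast_ne_zero.mpr (Nat.factorial_ne_zero m))]

theorem binomPoly_natDegree_le (m : ℕ) : (binomPoly m).natDegree ≤ m :=
  (natDegree_C_mul_le _ _).trans (descPochhammer_natDegree ℝ m).le

variable {E : Type*} [AddCommGroup E] [Module ℝ E]

/-- This is the binomial expansion of `(1 + M)^k`, with `M` the index shift; the induction step is
Pascal's rule. -/
theorem pow_apply_of_chain {A : Module.End ℝ E} {μ : ℝ} {d : ℕ} {e : ℕ → E}
    (h0 : 0 < d → A (e 0) = μ • e 0) (hs : ∀ j, j + 1 < d → A (e (j + 1)) = μ • (e j + e (j + 1)))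
    (k : ℕ) {j : ℕ} (hj : j < d) :
    (A ^ k) (e j) = μ ^ k • ∑ m ∈ Finset.range (j + 1), (k.choose m : ℝ) • e (j - m) := by
  induction k generalizing j with
  | zero =>
    rw [Finset.sum_range_succ']
    simp
  | succ k ih =>
    rw [pow_succ, Module.End.mul_apply]
    cases j with
    | zero =>
      rw [h0 hj, map_smul, ih hj, smul_smul, pow_succ']
      simp
    | succ j =>
      rw [hs j hj, map_smul, map_add, ih hj, ih (Nat.lt_of_succ_lt hj), ← smul_add, smul_smul,
        pow_succ']
      congr 1
      rw [Finset.sum_range_succ' _ (j + 1), Finset.sum_range_succ' _ (j + 1), ← add_assoc,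
        ← Finset.sum_add_distrib]
      congr 1
      · refine Finset.sum_congr rfl fun m _ => ?_
        rw [Nat.choose_succ_succ, Nat.cast_add, add_smul, Nat.add_sub_add_right]
      · simp

theorem isANT_iff_eventually (A : Module.End ℝ E) (f : Module.Dual ℝ E) (x : E) :
    IsANT A f x ↔ ∀ᶠ n in atTop, 0 < f ((A ^ n) x) := by
  rw [eventually_atTop]
  refine exists_congr fun k₀ => ⟨fun h n hn => ?_, fun h k => ?_⟩
  · have := h (n - k₀)
    rwa [← Module.End.mul_apply, ← pow_add, Nat.sub_add_cancel hn] at this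
  · rw [← Module.End.mul_apply, ← pow_add]
    exact h _ (Nat.le_add_left _ _)

variable [FiniteDimensional ℝ E] {A : Module.End ℝ E} {B : Module.Basis (Idx A) ℝ E}
  {f : Module.Dual ℝ E}

theorem IsAdapted.apply_pow_basis (hB : IsAdapted A B) (f : Module.Dual ℝ E) (k : ℕ) (μ : ℝ)
    (j : Fin (mult A μ)) :
    f ((A ^ k) (B ⟨μ, j⟩)) = μ ^ k * (basisPoly B f μ j).eval (k : ℝ) := by
  set e : ℕ → E := fun i => if h : i < mult A μ then B ⟨μ, ⟨i, h⟩⟩ else 0 with he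
  have hej : ∀ i (h : i < mult A μ), e i = B ⟨μ, ⟨i, h⟩⟩ := fun i h => by simp [he, h]
  have h := pow_apply_of_chain (A := A) (μ := μ) (d := mult A μ) (e := e)
    (fun h => by rw [hej 0 h, hB.map_first])
    (fun i hi => by rw [hej _ hi, hej i (Nat.lt_of_succ_lt hi), hB.map_succ]) k j.2
  rw [hej j j.2] at h
  rw [h, map_smul, map_sum, smul_eq_mul, basisPoly, eval_finsetSum]
  congr 1
  -- Reindex by `i = j - m`, so that the sum runs over the basis vectors as in `basisPoly`.
  rw [← Finset.sum_flip]
  have hI : Finset.range ((j : ℕ) + 1) = (Finset.Iic j).map Fin.valEmbedding := by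
    rw [Fin.map_valEmbedding_Iic]
    ext i
    simp
  rw [hI, Finset.sum_map]
  refine Finset.sum_congr rfl fun i hi => ?_
  have hij : i ≤ j := Finset.mem_Iic.mp hi
  have hij' : (i : ℕ) ≤ j := hij
  simp only [Fin.valEmbedding_apply, map_smul, smul_eq_mul, eval_mul, eval_C, binomPoly_eval]
  rw [Nat.sub_sub_self hij', hej i i.2, mul_comm]

theorem basisPoly_natDegree_lt (μ : ℝ) (j : Fin (mult A μ)) :
    (basisPoly B f μ j).natDegree < mult A μ := by
  refine lt_of_le_of_lt (natDegree_sum_le_of_forall_le _ _ fun i _ => ?_) j.2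
  exact (natDegree_C_mul_le _ _).trans ((binomPoly_natDegree_le _).trans (Nat.sub_le _ _))

theorem polyP_coeff (μ : ℝ) (l : ℕ) (x : E) : (polyP B f μ x).coeff l = phi B f μ l x := by
  rw [polyP, phi, finsetSum_coeff]
  exact Finset.sum_congr rfl fun j _ => by rw [coeff_C_mul, mul_comm]

theorem phi_eq_zero_of_mult_le {μ : ℝ} {l : ℕ} (h : mult A μ ≤ l) (x : E) :
    phi B f μ l x = 0 :=
  Finset.sum_eq_zero fun j _ => by
    rw [coeff_eq_zero_of_natDegree_lt ((basisPoly_natDegree_lt μ j).trans_le h), zero_mul]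

theorem polyP_eq_zero_of_not_hasEigenvalue {μ : ℝ} (h : ¬ A.HasEigenvalue μ) (x : E) :
    polyP B f μ x = 0 := by
  have h0 : mult A μ = 0 := by
    rw [hasEigenvalue_iff_mult_pos] at h
    omega
  ext l
  rw [polyP_coeff, phi_eq_zero_of_mult_le (by omega), coeff_zero]

theorem IsAdapted.apply_pow (hB : IsAdapted A B) (f : Module.Dual ℝ E) (k : ℕ) (x : E) :
    f ((A ^ k) x) = ∑ μ ∈ spec A, μ ^ k * (polyP B f μ x).eval (k : ℝ) := by
  conv_lhs => rw [← B.sum_repr x]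
  rw [map_sum, map_sum, sum_idx]
  refine Finset.sum_congr rfl fun μ _ => ?_
  rw [polyP, eval_finsetSum, Finset.mul_sum]
  refine Finset.sum_congr rfl fun j _ => ?_
  rw [map_smul, map_smul, hB.apply_pow_basis, smul_eq_mul, eval_mul, eval_C]
  ring

/-- The absolute values of the eigenvalues. -/
noncomputable def absSpec (A : Module.End ℝ E) : Finset ℝ := (spec A).image fun μ => |μ|

theorem abs_mem_absSpec {μ : ℝ} (h : μ ∈ spec A) : |μ| ∈ absSpec A :=
  Finset.mem_image_of_mem _ h

theorem pos_of_mem_absSpec (h0 : mult A 0 = 0) {t : ℝ} (ht : t ∈ absSpec A) : 0 < t := by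
  obtain ⟨μ, hμ, rfl⟩ := Finset.mem_image.mp ht
  refine abs_pos.mpr ?_
  rintro rfl
  exact (mem_spec.mp hμ).ne' h0

/-- Positive eigenvalues are matched with `t` and the others with `-t`. Values `±t` outside the
spectrum may be added freely, since `g` vanishes there. -/
theorem sum_spec_eq_sum_absSpec (h0 : mult A 0 = 0) {g : ℝ → ℝ} (hg : ∀ μ ∉ spec A, g μ = 0) :
    ∑ μ ∈ spec A, g μ = ∑ t ∈ absSpec A, (g t + g (-t)) := by
  rw [Finset.sum_add_distrib, ← Finset.sum_filter_add_sum_filter_not (spec A) (fun μ => 0 < μ)]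
  congr 1
  · refine Finset.sum_subset (fun μ hμ => ?_) fun t ht hn => ?_
    · obtain ⟨h1, h2⟩ := Finset.mem_filter.mp hμ
      simpa [abs_of_pos h2] using abs_mem_absSpec h1
    · exact hg t fun h => hn (Finset.mem_filter.mpr ⟨h, pos_of_mem_absSpec h0 ht⟩)
  · have hmap := Finset.sum_map (absSpec A) (Equiv.neg ℝ).toEmbedding g
    simp only [Equiv.coe_toEmbedding, Equiv.neg_apply] at hmap
    rw [← hmap]
    refine Finset.sum_subset (fun μ hμ => ?_) fun t ht hn => ?_
    · obtain ⟨h1, h2⟩ := Finset.mem_filter.mp hμ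
      refine Finset.mem_map.mpr ⟨|μ|, abs_mem_absSpec h1, ?_⟩
      simp [abs_of_nonpos (not_lt.mp h2)]
    · obtain ⟨s, hs, rfl⟩ := Finset.mem_map.mp ht
      refine hg _ fun h => hn (Finset.mem_filter.mpr ⟨h, ?_⟩)
      have := pos_of_mem_absSpec h0 hs
      simp [this.le]

theorem eventually_atTop_iff_even_odd {p : ℕ → Prop} :
    (∀ᶠ n in atTop, p n) ↔ (∀ᶠ m in atTop, p (2 * m)) ∧ ∀ᶠ m in atTop, p (2 * m + 1) := by
  simp only [eventually_atTop]
  constructor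
  · rintro ⟨N, h⟩
    exact ⟨⟨N, fun m hm => h _ (by omega)⟩, ⟨N, fun m hm => h _ (by omega)⟩⟩
  · rintro ⟨⟨a, ha⟩, b, hb⟩
    refine ⟨2 * a + 2 * b + 2, fun n hn => ?_⟩
    rcases Nat.even_or_odd' n with ⟨m, rfl | rfl⟩
    · exact ha m (by omega)
    · exact hb m (by omega)

theorem polyQPlus_of_nonneg {t : ℝ} (ht : 0 ≤ t) (x : E) :
    polyQPlus B f t x = polyP B f t x + polyP B f (-t) x := by
  rw [polyQPlus, abs_of_nonneg ht]

theorem polyQMinus_of_nonneg {t : ℝ} (ht : 0 ≤ t) (x : E) :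
    polyQMinus B f t x = polyP B f t x - polyP B f (-t) x := by
  rw [polyQMinus, abs_of_nonneg ht]

/-- Since `(-t)^k = ±t^k` according to the parity of `k`, even iterates see only `Q⁺` and odd
iterates only `Q⁻`. -/
theorem IsAdapted.isANT_iff_isDominantAt (hB : IsAdapted A B) (h0 : mult A 0 = 0) (x : E) :
    IsANT A f x ↔ (∃ t, IsDominantAt (fun t => polyQPlus B f t x) t) ∧
      ∃ t, IsDominantAt (fun t => polyQMinus B f t x) t := by
  have hT : ∀ t ∈ absSpec A, 0 < t := fun t ht => pos_of_mem_absSpec h0 ht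
  have hz : ∀ t, 0 < t → t ∉ absSpec A → polyP B f t x = 0 ∧ polyP B f (-t) x = 0 := by
    intro t ht hn
    constructor <;> refine polyP_eq_zero_of_not_hasEigenvalue (fun h => hn ?_) x <;>
      rw [hasEigenvalue_iff_mult_pos, ← mem_spec] at h <;>
      simpa only [abs_neg, abs_of_pos ht] using abs_mem_absSpec h
  have hzero : ∀ k : ℕ, ∀ μ ∉ spec A, μ ^ k * (polyP B f μ x).eval (k : ℝ) = 0 := by
    intro k μ hμ
    rw [mem_spec, ← hasEigenvalue_iff_mult_pos] at hμ
    rw [polyP_eq_zero_of_not_hasEigenvalue hμ, eval_zero, mul_zero]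
  have heven : Tendsto (fun m : ℕ => 2 * m) atTop atTop :=
    tendsto_atTop_mono (fun m => by simp only [id]; omega) tendsto_id
  have hodd : Tendsto (fun m : ℕ => 2 * m + 1) atTop atTop :=
    tendsto_atTop_mono (fun m => by simp only [id]; omega) tendsto_id
  rw [isANT_iff_eventually, eventually_atTop_iff_even_odd,
    ← eventually_sum_pos_iff hT (Q := fun t => polyQPlus B f t x) (fun t ht hn => by
      simp only [polyQPlus_of_nonneg ht.le, hz t ht hn, add_zero]) heven,
    ← eventually_sum_pos_iff hT (Q := fun t => polyQMinus B f t x) (fun t ht hn => by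
      simp only [polyQMinus_of_nonneg ht.le, hz t ht hn, sub_zero]) hodd]
  refine and_congr (eventually_congr (Eventually.of_forall fun m => ?_))
    (eventually_congr (Eventually.of_forall fun m => ?_))
  · rw [hB.apply_pow, sum_spec_eq_sum_absSpec h0 (hzero _)]
    refine iff_of_eq (congrArg _ (Finset.sum_congr rfl fun t ht => ?_))
    rw [polyQPlus_of_nonneg (hT t ht).le, eval_add, (even_two_mul m).neg_pow, mul_add]
  · rw [hB.apply_pow, sum_spec_eq_sum_absSpec h0 (hzero _)]
    refine iff_of_eq (congrArg _ (Finset.sum_congr rfl fun t ht => ?_))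
    rw [polyQMinus_of_nonneg (hT t ht).le, eval_sub, (odd_two_mul_add_one m).neg_pow]
    ring

end LoopProgram

/-! ### From coefficients to dominant terms -/

namespace LoopProgram

open Polynomial Filter Topology

theorem eq_zero_iff_of_coeff {p : ℝ[X]} {d : ℕ} (h : ∀ j, d ≤ j → p.coeff j = 0) :
    p = 0 ↔ ∀ j < d, p.coeff j = 0 := by
  refine ⟨fun h0 j _ => by simp [h0], fun h0 => ext fun j => ?_⟩
  rw [coeff_zero]
  exact (lt_or_ge j d).elim (h0 j) (h j)

theorem posDominant_iff_of_coeff {p : ℝ[X]} {d : ℕ} (h : ∀ j, d ≤ j → p.coeff j = 0) :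
    PosDominant p ↔ ∃ k < d, (∀ j < d, k < j → p.coeff j = 0) ∧ 0 < p.coeff k := by
  constructor
  · intro hp
    refine ⟨p.natDegree, ?_, fun j _ hj => coeff_eq_zero_of_natDegree_lt hj, hp⟩
    by_contra hn
    exact hp.ne' (h _ (not_lt.mp hn))
  · rintro ⟨k, hk, h1, h2⟩
    have hd : p.natDegree = k := by
      refine le_antisymm (natDegree_le_iff_coeff_eq_zero.mpr fun j hj => ?_)
        (le_natDegree_of_ne_zero h2.ne')
      exact (lt_or_ge j d).elim (fun hjd => h1 j hjd hj) (h j)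
    rwa [PosDominant, leadingCoeff, hd]

/-- If `q` had the larger degree, `p + q` and `p - q` would have opposite leading coefficients. -/
theorem PosDominant.natDegree_le_of_sub {p q : ℝ[X]} (hadd : PosDominant (p + q))
    (hsub : PosDominant (p - q)) : q.natDegree ≤ p.natDegree := by
  by_contra hlt
  have hdeg := degree_lt_degree (not_le.mp hlt)
  rw [PosDominant, leadingCoeff_add_of_degree_lt hdeg] at hadd
  rw [PosDominant, sub_eq_add_neg, leadingCoeff_add_of_degree_lt (by rwa [degree_neg]),
    leadingCoeff_neg] at hsub
  linarith

theorem posDominant_add_self_iff {p : ℝ[X]} : PosDominant (p + p) ↔ PosDominant p := by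
  have h : p + p = C 2 * p := by rw [← two_mul]; rfl
  rw [PosDominant, PosDominant, h, leadingCoeff_mul, leadingCoeff_C]
  exact mul_pos_iff_of_pos_left two_pos

variable {E : Type*} [AddCommGroup E] [Module ℝ E] [FiniteDimensional ℝ E]
  {A : Module.End ℝ E} {B : Module.Basis (Idx A) ℝ E} {f : Module.Dual ℝ E} {x : E}

theorem polyQPlus_coeff (μ : ℝ) (l : ℕ) (x : E) :
    (polyQPlus B f μ x).coeff l = phiPlus B f μ l x := by
  rw [polyQPlus, phiPlus, coeff_add, polyP_coeff, polyP_coeff]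

theorem polyQMinus_coeff (μ : ℝ) (l : ℕ) (x : E) :
    (polyQMinus B f μ x).coeff l = phiMinus B f μ l x := by
  rw [polyQMinus, phiMinus, coeff_sub, polyP_coeff, polyP_coeff]

theorem phiPlus_eq_zero_of_maxMult_le {μ : ℝ} {l : ℕ} (h : maxMult A μ ≤ l) (x : E) :
    phiPlus B f μ l x = 0 := by
  obtain ⟨h1, h2⟩ := max_le_iff.mp h
  rw [phiPlus, phi_eq_zero_of_mult_le h1, phi_eq_zero_of_mult_le h2, add_zero]

theorem phiMinus_eq_zero_of_maxMult_le {μ : ℝ} {l : ℕ} (h : maxMult A μ ≤ l) (x : E) :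
    phiMinus B f μ l x = 0 := by
  obtain ⟨h1, h2⟩ := max_le_iff.mp h
  rw [phiMinus, phi_eq_zero_of_mult_le h1, phi_eq_zero_of_mult_le h2, sub_zero]

theorem polyP_eq_zero_iff {μ : ℝ} :
    polyP B f μ x = 0 ↔ ∀ j < mult A μ, phi B f μ j x = 0 := by
  simpa only [polyP_coeff] using eq_zero_iff_of_coeff (p := polyP B f μ x)
    fun j hj => (polyP_coeff μ j x).trans (phi_eq_zero_of_mult_le hj x)

theorem polyQPlus_eq_zero_iff {μ : ℝ} :
    polyQPlus B f μ x = 0 ↔ ∀ j < maxMult A μ, phiPlus B f μ j x = 0 := by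
  simpa only [polyQPlus_coeff] using eq_zero_iff_of_coeff (p := polyQPlus B f μ x)
    fun j hj => (polyQPlus_coeff μ j x).trans (phiPlus_eq_zero_of_maxMult_le hj x)

theorem polyQMinus_eq_zero_iff {μ : ℝ} :
    polyQMinus B f μ x = 0 ↔ ∀ j < maxMult A μ, phiMinus B f μ j x = 0 := by
  simpa only [polyQMinus_coeff] using eq_zero_iff_of_coeff (p := polyQMinus B f μ x)
    fun j hj => (polyQMinus_coeff μ j x).trans (phiMinus_eq_zero_of_maxMult_le hj x)

theorem posDominant_polyP_iff {μ : ℝ} :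
    PosDominant (polyP B f μ x) ↔ ∃ k < mult A μ,
      (∀ j < mult A μ, k < j → phi B f μ j x = 0) ∧ 0 < phi B f μ k x := by
  simpa only [polyP_coeff] using posDominant_iff_of_coeff (p := polyP B f μ x)
    fun j hj => (polyP_coeff μ j x).trans (phi_eq_zero_of_mult_le hj x)

theorem posDominant_polyQPlus_iff {μ : ℝ} :
    PosDominant (polyQPlus B f μ x) ↔ ∃ k < maxMult A μ,
      (∀ j < maxMult A μ, k < j → phiPlus B f μ j x = 0) ∧ 0 < phiPlus B f μ k x := by
  simpa only [polyQPlus_coeff] using posDominant_iff_of_coeff (p := polyQPlus B f μ x)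
    fun j hj => (polyQPlus_coeff μ j x).trans (phiPlus_eq_zero_of_maxMult_le hj x)

theorem posDominant_polyQMinus_iff {μ : ℝ} :
    PosDominant (polyQMinus B f μ x) ↔ ∃ k < maxMult A μ,
      (∀ j < maxMult A μ, k < j → phiMinus B f μ j x = 0) ∧ 0 < phiMinus B f μ k x := by
  simpa only [polyQMinus_coeff] using posDominant_iff_of_coeff (p := polyQMinus B f μ x)
    fun j hj => (polyQMinus_coeff μ j x).trans (phiMinus_eq_zero_of_maxMult_le hj x)

theorem polyQPlus_eq_add_self {l : ℝ} (hl : 0 ≤ l) (h : polyQMinus B f l x = 0) :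
    polyQPlus B f l x = polyP B f l x + polyP B f l x := by
  rw [polyQMinus_of_nonneg hl, sub_eq_zero] at h
  rw [polyQPlus_of_nonneg hl, ← h]

theorem polyQMinus_eq_add_self {l : ℝ} (hl : 0 ≤ l) (h : polyQPlus B f l x = 0) :
    polyQMinus B f l x = polyP B f l x + polyP B f l x := by
  rw [polyQPlus_of_nonneg hl, add_eq_zero_iff_neg_eq'] at h
  rw [polyQMinus_of_nonneg hl, ← h, sub_eq_add_neg]

/-- When `Q⁻_λ = 0`, `Q⁺_λ = 2 P_λ`. This is why the pieces can use `φ_λ` and the bound `k < d_λ` in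
place of `φ⁺_λ` and `e_λ`. -/
theorem mem_setU_iff : x ∈ setU B f ↔ SituationU B f x := by
  have key : ∀ l : ℝ, 0 < l → polyQMinus B f l x = 0 →
      (PosDominant (polyQPlus B f l x) ↔ PosDominant (polyP B f l x)) := fun l hl h => by
    rw [polyQPlus_eq_add_self hl.le h, posDominant_add_self_iff]
  constructor
  · rintro ⟨l, l', k, k', hl, he, he', hlt, hk, hk', h1, h2, h3, h4, h5, h6, h7⟩
    have hQ := polyQMinus_eq_zero_iff.mpr h2
    exact ⟨l, l', hl, he, he', hlt, fun μ hμ h => polyP_eq_zero_iff.mpr (h1 μ hμ h), hQ,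
      (key l hl hQ).mpr (posDominant_polyP_iff.mpr ⟨k, hk, h4, h6⟩),
      fun μ hμ h h' => polyQMinus_eq_zero_iff.mpr (h3 μ hμ h h'),
      posDominant_polyQMinus_iff.mpr ⟨k', hk', h5, h7⟩⟩
  · rintro ⟨l, l', hl, he, he', hlt, h1, h2, h3, h4, h5⟩
    obtain ⟨k, hk, hk1, hk2⟩ := posDominant_polyP_iff.mp ((key l hl h2).mp h3)
    obtain ⟨k', hk', hk1', hk2'⟩ := posDominant_polyQMinus_iff.mp h5
    exact ⟨l, l', k, k', hl, he, he', hlt, hk, hk',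
      fun μ hμ h => polyP_eq_zero_iff.mp (h1 μ hμ h), polyQMinus_eq_zero_iff.mp h2,
      fun μ hμ h h' => polyQMinus_eq_zero_iff.mp (h4 μ hμ h h'), hk1, hk1', hk2, hk2'⟩

theorem mem_setV_iff : x ∈ setV B f ↔ SituationV B f x := by
  have key : ∀ l : ℝ, 0 < l → polyQPlus B f l x = 0 →
      (PosDominant (polyQMinus B f l x) ↔ PosDominant (polyP B f l x)) := fun l hl h => by
    rw [polyQMinus_eq_add_self hl.le h, posDominant_add_self_iff]
  constructor
  · rintro ⟨l, l', k, k', hl, he, he', hlt, hk, hk', h1, h2, h3, h4, h5, h6, h7⟩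
    have hQ := polyQPlus_eq_zero_iff.mpr h2
    exact ⟨l, l', hl, he, he', hlt, fun μ hμ h => polyP_eq_zero_iff.mpr (h1 μ hμ h), hQ,
      (key l hl hQ).mpr (posDominant_polyP_iff.mpr ⟨k, hk, h4, h6⟩),
      fun μ hμ h h' => polyQPlus_eq_zero_iff.mpr (h3 μ hμ h h'),
      posDominant_polyQPlus_iff.mpr ⟨k', hk', h5, h7⟩⟩
  · rintro ⟨l, l', hl, he, he', hlt, h1, h2, h3, h4, h5⟩
    obtain ⟨k, hk, hk1, hk2⟩ := posDominant_polyP_iff.mp ((key l hl h2).mp h3)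
    obtain ⟨k', hk', hk1', hk2'⟩ := posDominant_polyQPlus_iff.mp h5
    exact ⟨l, l', k, k', hl, he, he', hlt, hk, hk',
      fun μ hμ h => polyP_eq_zero_iff.mp (h1 μ hμ h), polyQPlus_eq_zero_iff.mp h2,
      fun μ hμ h h' => polyQPlus_eq_zero_iff.mp (h4 μ hμ h h'), hk1, hk1', hk2, hk2'⟩

/-- The delicate point is `k, k' < d_λ` when `d_{-λ} > d_λ`. Positivity of both dominant terms
forces `deg P_{-λ} ≤ deg P_λ < d_λ`, so coefficients of index at least `d_λ` vanish. -/
theorem mem_setS_iff : x ∈ setS B f ↔ SituationS B f x := by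
  constructor
  · rintro ⟨l, k, k', hl, he, hk, hk', h1, h2, h3, h4, h5⟩
    have hle : mult A l ≤ maxMult A l := by
      rw [maxMult, abs_of_pos hl]
      exact le_max_left _ _
    exact ⟨l, hl, he, posDominant_polyQPlus_iff.mpr ⟨k, hk.trans_le hle, h2, h4⟩,
      posDominant_polyQMinus_iff.mpr ⟨k', hk'.trans_le hle, h3, h5⟩,
      fun μ hμ h => polyP_eq_zero_iff.mpr (h1 μ hμ h)⟩
  · rintro ⟨l, hl, he, h1, h2, h3⟩
    obtain ⟨k, -, hk1, hk2⟩ := posDominant_polyQPlus_iff.mp h1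
    obtain ⟨k', -, hk1', hk2'⟩ := posDominant_polyQMinus_iff.mp h2
    have hdeg := PosDominant.natDegree_le_of_sub (polyQPlus_of_nonneg hl.le x ▸ h1)
      (polyQMinus_of_nonneg hl.le x ▸ h2)
    have hlt : ∀ j, mult A l ≤ j → phi B f l j x = 0 ∧ phi B f (-l) j x = 0 := by
      intro j hj
      have h0 := phi_eq_zero_of_mult_le (B := B) (f := f) hj x
      refine ⟨h0, ?_⟩
      rw [← polyP_coeff]
      refine coeff_eq_zero_of_natDegree_lt (hdeg.trans_lt ?_)
      have hpos := (hasEigenvalue_iff_mult_pos A l).mp he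
      refine (Nat.le_sub_one_of_lt ?_).trans_lt ((Nat.sub_one_lt hpos.ne').trans_le hj)
      -- If `deg P_λ ≥ d_λ`, the leading coefficient would be a vanishing `φ_λ`; then `P_λ = 0` has
      -- degree `0`, contradicting `d_λ > 0`.
      by_contra hge
      have hlead := polyP_coeff (B := B) (f := f) l (polyP B f l x).natDegree x
      rw [phi_eq_zero_of_mult_le (not_lt.mp hge), coeff_natDegree, leadingCoeff_eq_zero] at hlead
      rw [hlead, natDegree_zero] at hge
      exact hge hpos
    refine ⟨l, k, k', hl, he, ?_, ?_, fun μ hμ h => polyP_eq_zero_iff.mp (h3 μ hμ h), hk1, hk1',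
      hk2, hk2'⟩
    · by_contra hn
      obtain ⟨ha, hb⟩ := hlt k (not_lt.mp hn)
      rw [phiPlus, abs_of_pos hl, ha, hb, add_zero] at hk2
      exact hk2.ne rfl
    · by_contra hn
      obtain ⟨ha, hb⟩ := hlt k' (not_lt.mp hn)
      rw [phiMinus, abs_of_pos hl, ha, hb, sub_zero] at hk2'
      exact hk2'.ne rfl

/-! ### The three situations as a comparison of dominant radii -/

theorem hasEigenvalue_of_polyP_ne_zero {μ : ℝ} (h : polyP B f μ x ≠ 0) : A.HasEigenvalue μ :=
  not_not.mp fun hn => h (polyP_eq_zero_of_not_hasEigenvalue hn x)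

theorem polyP_eq_zero_and_iff {t : ℝ} (ht : 0 ≤ t) :
    polyP B f t x = 0 ∧ polyP B f (-t) x = 0 ↔
      polyQPlus B f t x = 0 ∧ polyQMinus B f t x = 0 := by
  rw [polyQPlus_of_nonneg ht, polyQMinus_of_nonneg ht]
  constructor
  · rintro ⟨h1, h2⟩
    simp [h1, h2]
  · rintro ⟨h1, h2⟩
    rw [sub_eq_zero] at h2
    rw [← h2, ← two_mul] at h1
    have h := (mul_eq_zero.mp h1).resolve_left two_ne_zero
    exact ⟨h, h2 ▸ h⟩

theorem forall_polyP_eq_zero_iff {l : ℝ} (hl : 0 ≤ l) :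
    (∀ μ : ℝ, A.HasEigenvalue μ → l < |μ| → polyP B f μ x = 0) ↔
      ∀ t, l < t → polyQPlus B f t x = 0 ∧ polyQMinus B f t x = 0 := by
  constructor
  · intro h t ht
    have h' : ∀ μ, |μ| = t → polyP B f μ x = 0 := fun μ hμ => by
      by_contra hn
      exact hn (h μ (hasEigenvalue_of_polyP_ne_zero hn) (hμ ▸ ht))
    have ht0 := hl.trans ht.le
    exact (polyP_eq_zero_and_iff ht0).mp
      ⟨h' t (abs_of_nonneg ht0), h' (-t) ((abs_neg t).trans (abs_of_nonneg ht0))⟩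
  · intro h μ _ hμ
    obtain ⟨h1, h2⟩ := (polyP_eq_zero_and_iff (abs_nonneg μ)).mpr (h _ hμ)
    rcases abs_choice μ with hc | hc
    · rwa [hc] at h1
    · rwa [hc, neg_neg] at h2

theorem exists_hasEigenvalue_abs_eq {t : ℝ} (ht : 0 ≤ t)
    (h : ¬ (polyQPlus B f t x = 0 ∧ polyQMinus B f t x = 0)) :
    ∃ μ, A.HasEigenvalue μ ∧ |μ| = t := by
  rw [← polyP_eq_zero_and_iff ht, not_and_or] at h
  rcases h with h | h
  · exact ⟨t, hasEigenvalue_of_polyP_ne_zero h, abs_of_nonneg ht⟩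
  · exact ⟨-t, hasEigenvalue_of_polyP_ne_zero h, (abs_neg t).trans (abs_of_nonneg ht)⟩

theorem polyQPlus_abs (μ : ℝ) (x : E) : polyQPlus B f |μ| x = polyQPlus B f μ x := by
  rw [polyQPlus, polyQPlus, abs_abs]

theorem polyQMinus_abs (μ : ℝ) (x : E) : polyQMinus B f |μ| x = polyQMinus B f μ x := by
  rw [polyQMinus, polyQMinus, abs_abs]

theorem situationS_iff : SituationS B f x ↔
    ∃ t, IsDominantAt (fun t => polyQPlus B f t x) t ∧
      IsDominantAt (fun t => polyQMinus B f t x) t := by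
  constructor
  · rintro ⟨l, hl, he, h1, h2, h3⟩
    rw [forall_polyP_eq_zero_iff hl.le] at h3
    exact ⟨l, ⟨hl, h1, fun s hs => (h3 s hs).1⟩, hl, h2, fun s hs => (h3 s hs).2⟩
  · rintro ⟨l, ⟨hl, h1, h1'⟩, -, h2, h2'⟩
    -- The radius itself, not only its opposite, is an eigenvalue: if `P_l = 0`, then `Q⁺ = P_{-l}`
    -- and `Q⁻ = -P_{-l}` cannot both be positively dominant.
    refine ⟨l, hl, hasEigenvalue_of_polyP_ne_zero (B := B) (f := f) (x := x) fun h0 => ?_, h1, h2,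
      (forall_polyP_eq_zero_iff hl.le).mpr fun t ht => ⟨h1' t ht, h2' t ht⟩⟩
    simp only [polyQPlus_of_nonneg hl.le, polyQMinus_of_nonneg hl.le, h0, zero_add, zero_sub,
      PosDominant, leadingCoeff_neg] at h1 h2
    linarith

/-- The smaller radius is `|λ'|`, since `λ'` may be a negative eigenvalue; it is positive because
`0` is not an eigenvalue. The larger one is an eigenvalue because there `Q⁺ = 2 P_λ ≠ 0`. -/
theorem situationU_iff (h0 : mult A 0 = 0) : SituationU B f x ↔
    ∃ t t', t' < t ∧ IsDominantAt (fun t => polyQPlus B f t x) t ∧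
      IsDominantAt (fun t => polyQMinus B f t x) t' := by
  constructor
  · rintro ⟨l, l', hl, he, he', hlt, h1, h2, h3, h4, h5⟩
    rw [forall_polyP_eq_zero_iff hl.le] at h1
    have hl' : l' ≠ 0 := by
      rintro rfl
      exact ((hasEigenvalue_iff_mult_pos A 0).mp he').ne' h0
    refine ⟨l, |l'|, hlt, ⟨hl, h3, fun s hs => (h1 s hs).1⟩, abs_pos.mpr hl', ?_, fun s hs => ?_⟩
    · simpa only [polyQMinus_abs] using h5
    · rcases lt_trichotomy s l with h | rfl | h
      · by_contra hn
        obtain ⟨μ, hμ, rfl⟩ := exists_hasEigenvalue_abs_eq ((abs_nonneg l').trans hs.le)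
          fun hh => hn hh.2
        exact hn ((polyQMinus_abs μ x).trans (h4 μ hμ hs h))
      · exact h2
      · exact (h1 s h).2
  · rintro ⟨l, t, hlt, ⟨hl, h1, h1'⟩, ht, h2, h2'⟩
    obtain ⟨l', he', rfl⟩ := exists_hasEigenvalue_abs_eq ht.le fun hh => h2.ne_zero hh.2
    refine ⟨l, l', hl, ?_, he', hlt, (forall_polyP_eq_zero_iff hl.le).mpr fun t ht =>
      ⟨h1' t ht, h2' t (hlt.trans ht)⟩, h2' l hlt, h1, fun μ _ hμ _ => ?_, ?_⟩
    · refine hasEigenvalue_of_polyP_ne_zero (B := B) (f := f) (x := x) fun hP => h1.ne_zero ?_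
      simp only [polyQPlus_eq_add_self hl.le (h2' l hlt), hP, add_zero]
    · exact (polyQMinus_abs μ x).symm.trans (h2' _ hμ)
    · simpa only [polyQMinus_abs] using h2

theorem situationV_iff (h0 : mult A 0 = 0) : SituationV B f x ↔
    ∃ t t', t' < t ∧ IsDominantAt (fun t => polyQMinus B f t x) t ∧
      IsDominantAt (fun t => polyQPlus B f t x) t' := by
  constructor
  · rintro ⟨l, l', hl, he, he', hlt, h1, h2, h3, h4, h5⟩
    rw [forall_polyP_eq_zero_iff hl.le] at h1
    have hl' : l' ≠ 0 := by
      rintro rfl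
      exact ((hasEigenvalue_iff_mult_pos A 0).mp he').ne' h0
    refine ⟨l, |l'|, hlt, ⟨hl, h3, fun s hs => (h1 s hs).2⟩, abs_pos.mpr hl', ?_, fun s hs => ?_⟩
    · simpa only [polyQPlus_abs] using h5
    · rcases lt_trichotomy s l with h | rfl | h
      · by_contra hn
        obtain ⟨μ, hμ, rfl⟩ := exists_hasEigenvalue_abs_eq ((abs_nonneg l').trans hs.le)
          fun hh => hn hh.1
        exact hn ((polyQPlus_abs μ x).trans (h4 μ hμ hs h))
      · exact h2
      · exact (h1 s h).1
  · rintro ⟨l, t, hlt, ⟨hl, h1, h1'⟩, ht, h2, h2'⟩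
    obtain ⟨l', he', rfl⟩ := exists_hasEigenvalue_abs_eq ht.le fun hh => h2.ne_zero hh.1
    refine ⟨l, l', hl, ?_, he', hlt, (forall_polyP_eq_zero_iff hl.le).mpr fun t ht =>
      ⟨h2' t (hlt.trans ht), h1' t ht⟩, h2' l hlt, h1, fun μ _ hμ _ => ?_, ?_⟩
    · refine hasEigenvalue_of_polyP_ne_zero (B := B) (f := f) (x := x) fun hP => h1.ne_zero ?_
      simp only [polyQMinus_eq_add_self hl.le (h2' l hlt), hP, add_zero]
    · exact (polyQPlus_abs μ x).symm.trans (h2' _ hμ)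
    · simpa only [polyQPlus_abs] using h2

theorem isANT_iff_situation (hB : IsAdapted A B) (h0 : mult A 0 = 0) (x : E) :
    IsANT A f x ↔ SituationS B f x ∨ SituationU B f x ∨ SituationV B f x := by
  rw [hB.isANT_iff_isDominantAt h0, situationS_iff, situationU_iff h0, situationV_iff h0]
  constructor
  · rintro ⟨⟨t, ht⟩, t', ht'⟩
    rcases lt_trichotomy t t' with h | rfl | h
    · exact Or.inr (Or.inr ⟨t', t, h, ht', ht⟩)
    · exact Or.inl ⟨t, ht, ht'⟩
    · exact Or.inr (Or.inl ⟨t, t', h, ht, ht'⟩)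
  · rintro (⟨t, h, h'⟩ | ⟨t, t', -, h, h'⟩ | ⟨t, t', -, h', h⟩)
    exacts [⟨⟨t, h⟩, t, h'⟩, ⟨⟨t, h⟩, t', h'⟩, ⟨⟨t', h⟩, t, h'⟩]

theorem disjoint_setS_setU (h0 : mult A 0 = 0) : Disjoint (setS B f) (setU B f) := by
  refine Set.disjoint_left.mpr fun x hS hU => ?_
  obtain ⟨t, h, h'⟩ := situationS_iff.mp (mem_setS_iff.mp hS)
  obtain ⟨s, s', hlt, hs, hs'⟩ := (situationU_iff h0).mp (mem_setU_iff.mp hU)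
  exact hlt.ne ((hs'.unique h').trans (h.unique hs))

theorem disjoint_setS_setV (h0 : mult A 0 = 0) : Disjoint (setS B f) (setV B f) := by
  refine Set.disjoint_left.mpr fun x hS hV => ?_
  obtain ⟨t, h, h'⟩ := situationS_iff.mp (mem_setS_iff.mp hS)
  obtain ⟨s, s', hlt, hs, hs'⟩ := (situationV_iff h0).mp (mem_setV_iff.mp hV)
  exact hlt.ne ((hs'.unique h).trans (h'.unique hs))

theorem disjoint_setU_setV (h0 : mult A 0 = 0) : Disjoint (setU B f) (setV B f) := by
  refine Set.disjoint_left.mpr fun x hU hV => ?_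
  obtain ⟨t, t', hlt, h, h'⟩ := (situationU_iff h0).mp (mem_setU_iff.mp hU)
  obtain ⟨s, s', hlt', hs, hs'⟩ := (situationV_iff h0).mp (mem_setV_iff.mp hV)
  -- Uniqueness of the radii gives `s' = t` and `t' = s`, incompatible with `t' < t` and `s' < s`.
  have h1 := hs'.unique h
  have h2 := h'.unique hs
  linarith

end LoopProgram

theorem mainTheorem1 {E : Type*} [AddCommGroup E] [Module ℝ E] [FiniteDimensional ℝ E]
    (A : Module.End ℝ E) (f : Module.Dual ℝ E)
    (hspec : A.charpoly.Splits)
    (hK : LoopProgram.kerSpace A f = ⊥)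
    (hE0 : LoopProgram.genSpace A 0 = ⊥) :
    (∃ B : Module.Basis (LoopProgram.Idx A) ℝ E, LoopProgram.IsAdapted A B) ∧
    ∀ B : Module.Basis (LoopProgram.Idx A) ℝ E, LoopProgram.IsAdapted A B →
      (∀ x : E, LoopProgram.IsANT A f x ↔
        LoopProgram.SituationS B f x ∨ LoopProgram.SituationU B f x ∨
          LoopProgram.SituationV B f x) ∧
      LoopProgram.antSet A f =
        LoopProgram.setS B f ∪ LoopProgram.setU B f ∪ LoopProgram.setV B f ∧
      Disjoint (LoopProgram.setS B f) (LoopProgram.setU B f) ∧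
      Disjoint (LoopProgram.setS B f) (LoopProgram.setV B f) ∧
      Disjoint (LoopProgram.setU B f) (LoopProgram.setV B f) := by
  have h0 := LoopProgram.mult_zero_of_genSpace_zero hE0
  refine ⟨LoopProgram.exists_isAdapted hspec hK hE0, fun B hB =>
    ⟨LoopProgram.isANT_iff_situation hB h0, ?_, LoopProgram.disjoint_setS_setU h0,
      LoopProgram.disjoint_setS_setV h0, LoopProgram.disjoint_setU_setV h0⟩⟩
  refine Set.ext fun x => (LoopProgram.isANT_iff_situation hB h0 x).trans ?_
  rw [Set.mem_union, Set.mem_union, LoopProgram.mem_setS_iff, LoopProgram.mem_setU_iff,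
    LoopProgram.mem_setV_iff, or_assoc]
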